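/- A framed 4-graph is a finite 4-valent graph in which the four half-edges at each vertex (crossing) are split into two pairs of formally opposite half-edges; circles without vertices are admitted as graphs and as components. Equivalently, it is obtained from a finite disjoint union of circles by gluing finitely many disjoint pairs of points transversally, opposite half-edges being those that continue each other along a circle. Let $\Gamma_1,\Gamma_2$ be framed 4-graphs. A cobordism between them is a Hausdorff space $K=f(\Sigma)$, where $\Sigma$ is a compact orientable surface (possibly disconnected) and $f$ is a continuous surjection, such that: (i) near each point of $K$, up to homeomorphism of source and target, $f$ has one of the following forms: the inclusion of a plane; of two coordinate planes in $\mathbb R^3$ crossing along a double line; of three coordinate planes in $\mathbb R^3$ (a triple point); the Whitney umbrella $(u,v)\mapsto(u^2,uv,v)$ (a cusp); the inclusion of a half-plane; or of two half-planes crossing along a half-line that ends on the boundary (a crossing of the boundary graph); (ii) $\partial K=\Gamma_1\sqcup\Gamma_2$, that is, $\partial\Sigma$ is identified with the circles of $\Gamma_1\sqcup\Gamma_2$ so that $f$ glues points of $\partial\Sigma$ exactly as they are glued in $\Gamma_1\sqcup\Gamma_2$. The genus of the cobordism is the total genus of $\Sigma$ (the sum of the genera of its components). A double line of $K$ is the image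 of a connected component of the closure in $\Sigma\times\Sigma$ of $\{(x,x') : x\ne x',\ f(x)=f(x')\}$. The cobordism is elementary if $K$ has neither cusps nor triple points. **Theorem.** Suppose that there is a cobordism of genus $g$ between $\Gamma_1$ and $\Gamma_2$ whose complex $K$ has no triple points and no double line containing both a cusp and a point of $\partial K$. Then there is an elementary cobordism between $\Gamma_1$ and $\Gamma_2$ (with the same boundary $\Gamma_1\sqcup\Gamma_2$), of genus at most $g$. Moreover, it can be chosen so that the connected components of its surface $\Sigma'$ correspond bijectively to those of $\Sigma$, with corresponding components bounded by the same circles of $\Gamma_1\sqcup\Gamma_2$. -/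

import Mathlib

open Set Topology
open scoped Manifold

universe u

/-! ### Framed 4-graphs -/

/-- A framed 4-graph, presented by its unicursal components: finitely many circles, indexed by `ι`,
with finitely many disjoint pairs of points glued together transversally. The gluing is recorded by
the involution `glue` that swaps the two points of each pair and fixes all other points. Each glued
pair is a crossing; the formally opposite half-edges at a crossing are those that continue each
other along a circle. A circle without glued points is a component without vertices. -/
structure FramedFourGraph where
  ι : Type
  [finite_ι : Finite ι]
  glue : (Σ _ : ι, Circle) → (Σ _ : ι, Circle)
  glue_involutive : Function.Involutive glue
  finite_crossings : {p | glue p ≠ p}.Finite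

namespace FramedFourGraph

/-- The disjoint union of circles of which the graph is the image. -/
abbrev Circles (Γ : FramedFourGraph) : Type := Σ _ : Γ.ι, Circle

/-- Two points of the circles are the same point of the graph. -/
def SamePoint (Γ : FramedFourGraph) (a b : Γ.Circles) : Prop := a = b ∨ Γ.glue a = b

/-- The gluing involution of a disjoint union. -/
def sumGlue (Γ₁ Γ₂ : FramedFourGraph) :
    (Σ _ : Γ₁.ι ⊕ Γ₂.ι, Circle) → (Σ _ : Γ₁.ι ⊕ Γ₂.ι, Circle)
  | ⟨Sum.inl i, z⟩ => ⟨Sum.inl (Γ₁.glue ⟨i, z⟩).1, (Γ₁.glue ⟨i, z⟩).2⟩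
  | ⟨Sum.inr i, z⟩ => ⟨Sum.inr (Γ₂.glue ⟨i, z⟩).1, (Γ₂.glue ⟨i, z⟩).2⟩

theorem sumGlue_involutive (Γ₁ Γ₂ : FramedFourGraph) :
    Function.Involutive (sumGlue Γ₁ Γ₂) := by
  rintro ⟨i | i, z⟩
  · have h := Γ₁.glue_involutive ⟨i, z⟩
    simp only [sumGlue, Sigma.eta, h]
  · have h := Γ₂.glue_involutive ⟨i, z⟩
    simp only [sumGlue, Sigma.eta, h]

theorem sumGlue_finite (Γ₁ Γ₂ : FramedFourGraph) :
    {p | sumGlue Γ₁ Γ₂ p ≠ p}.Finite := by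
  have h₁ := Γ₁.finite_crossings.image
    (fun p => (⟨Sum.inl p.1, p.2⟩ : Σ _ : Γ₁.ι ⊕ Γ₂.ι, Circle))
  have h₂ := Γ₂.finite_crossings.image
    (fun p => (⟨Sum.inr p.1, p.2⟩ : Σ _ : Γ₁.ι ⊕ Γ₂.ι, Circle))
  refine (h₁.union h₂).subset ?_
  rintro ⟨i | i, z⟩ hp
  · refine Or.inl ⟨⟨i, z⟩, fun h => hp ?_, rfl⟩
    simp only [sumGlue, h]
  · refine Or.inr ⟨⟨i, z⟩, fun h => hp ?_, rfl⟩
    simp only [sumGlue, h]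

/-- The disjoint union of two framed 4-graphs. -/
def disjUnion (Γ₁ Γ₂ : FramedFourGraph) : FramedFourGraph :=
  haveI := Γ₁.finite_ι
  haveI := Γ₂.finite_ι
  { ι := Γ₁.ι ⊕ Γ₂.ι
    glue := sumGlue Γ₁ Γ₂
    glue_involutive := sumGlue_involutive Γ₁ Γ₂
    finite_crossings := sumGlue_finite Γ₁ Γ₂ }

end FramedFourGraph

/-! ### Surfaces: orientability and genus

A surface is a Hausdorff space with charts in the closed half-plane `EuclideanHalfSpace 2`;
its boundary is `(𝓡∂ 2).boundary S`. -/

/-- A surface is orientable if it contains no Möbius band. The band is the quotient of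
`ℝ × [-1, 1]` by `(s, t) ∼ (s + k, (-1) ^ k t)`, `k ∈ ℤ`. It is compact, so that an injective
continuous map of it to a Hausdorff space is an embedding. -/
def OrientableSurface (S : Type u) [TopologicalSpace S] : Prop :=
  ¬ ∃ m : ℝ × Icc (-1 : ℝ) 1 → S, Continuous m ∧
    ∀ p q, m p = m q ↔ ∃ k : ℤ, q.1 = p.1 + k ∧ (q.2 : ℝ) = (-1) ^ k * (p.2 : ℝ)

/-- `c` is a family of `n` pairwise disjoint simple closed curves in the interior of the surface
`S`, whose union does not separate any connected component of `S`. -/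
def IsNonseparatingSystem (S : Type u) [TopologicalSpace S] [ChartedSpace (EuclideanHalfSpace 2) S]
    (n : ℕ) (c : (Σ _ : Fin n, Circle) → S) : Prop :=
  Continuous c ∧ Function.Injective c ∧ Disjoint (range c) ((𝓡∂ 2).boundary S) ∧
    ∀ x : S, IsPreconnected (connectedComponent x \ range c)

/-- `g` is the (total) genus of the compact orientable surface `S`: the largest number of disjoint
simple closed curves in its interior that together separate no component of `S`. For a disconnected
surface this is the sum of the genera of the components. -/
def HasTotalGenus (S : Type u) [TopologicalSpace S] [ChartedSpace (EuclideanHalfSpace 2) S]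
    (g : ℕ) : Prop :=
  IsGreatest {n : ℕ | ∃ c, IsNonseparatingSystem S n c} g

/-! ### Local models of standard complexes -/

namespace LocalModel

/-- The closed half-plane. -/
abbrev HalfPlane : Type := {p : ℝ × ℝ // 0 ≤ p.1}

/-- A coordinate plane in `ℝ³`. -/
def sheet : ℝ × ℝ → ℝ × ℝ × ℝ := fun p => (p.1, p.2, 0)

/-- Two coordinate planes, crossing along a double line. -/
def double : (ℝ × ℝ) ⊕ (ℝ × ℝ) → ℝ × ℝ × ℝ :=
  Sum.elim (fun p => (p.1, p.2, 0)) (fun p => (p.1, 0, p.2))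

/-- Three coordinate planes, crossing in a triple point. -/
def triple : (ℝ × ℝ) ⊕ (ℝ × ℝ) ⊕ (ℝ × ℝ) → ℝ × ℝ × ℝ :=
  Sum.elim (fun p => (p.1, p.2, 0)) (Sum.elim (fun p => (p.1, 0, p.2)) (fun p => (0, p.1, p.2)))

/-- The Whitney umbrella: a double line (the first half-axis) ending in a cusp. -/
def cusp : ℝ × ℝ → ℝ × ℝ × ℝ := fun p => (p.1 ^ 2, p.1 * p.2, p.2)

/-- A half-plane: the neighbourhood of a boundary point that is not a crossing. -/
def halfSheet : HalfPlane → ℝ × ℝ × ℝ := fun p => (p.1.1, p.1.2, 0)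

/-- Two half-planes crossing along a double half-line that ends on the boundary: the neighbourhood
of a crossing of the boundary graph. -/
def halfDouble : HalfPlane ⊕ HalfPlane → ℝ × ℝ × ℝ :=
  Sum.elim (fun p => (p.1.1, p.1.2, 0)) (fun p => (p.1.1, 0, p.1.2))

end LocalModel

section LocalStructure

variable {S K X : Type*} [TopologicalSpace S] [TopologicalSpace K] [TopologicalSpace X]

/-- Over some open neighbourhood `V` of `y`, the map `f : f⁻¹(V) → V` is, up to homeomorphisms of
the source and of the target, the model map `m` from `X` onto its image in `ℝ³`, with `y`
corresponding to the origin. -/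
def IsModelledAt (f : S → K) (y : K) (m : X → ℝ × ℝ × ℝ) : Prop :=
  ∃ (V : Set K) (hy : y ∈ V), IsOpen V ∧
    ∃ (φ : (f ⁻¹' V) ≃ₜ X) (ψ : V ≃ₜ range m),
      (∀ x : f ⁻¹' V, (ψ ⟨f x, x.2⟩ : ℝ × ℝ × ℝ) = m (φ x)) ∧ (ψ ⟨y, hy⟩ : ℝ × ℝ × ℝ) = 0

def IsTriplePoint (f : S → K) (y : K) : Prop := IsModelledAt f y LocalModel.triple

def IsCuspPoint (f : S → K) (y : K) : Prop := IsModelledAt f y LocalModel.cusp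

/-- Every point has one of the local forms allowed in a standard complex with boundary. -/
def IsStandardMap (f : S → K) : Prop :=
  ∀ y : K, IsModelledAt f y LocalModel.sheet ∨ IsModelledAt f y LocalModel.double ∨
    IsTriplePoint f y ∨ IsCuspPoint f y ∨
    IsModelledAt f y LocalModel.halfSheet ∨ IsModelledAt f y LocalModel.halfDouble

/-- The double point set in the source: the closure of the set of pairs of distinct points that `f`
glues together. For a standard complex the closure adds the pairs `(c, c)` with `c` over a cusp;
the set is a compact 1-manifold, in which the branches through a triple point are separated. -/
def doublePairs (f : S → K) : Set (S × S) :=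
  closure {p | p.1 ≠ p.2 ∧ f p.1 = f p.2}

/-- A double line of the complex: the image of a connected component of the double point set. -/
def IsDoubleLine (f : S → K) (L : Set K) : Prop :=
  ∃ p ∈ doublePairs f, L = (fun q : S × S => f q.1) '' connectedComponentIn (doublePairs f) p

end LocalStructure

/-! ### Standard complexes with boundary, and cobordisms -/

/-- A standard complex `K` with boundary the framed 4-graph `Γ`: the image of a compact orientable
surface `S` (possibly disconnected) under a map `f` that pastes points generically, together with an
identification of `∂S` with the circles of `Γ` under which `f` pastes points of `∂S` exactly as they
are pasted in `Γ`. -/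
structure StandardComplex (Γ : FramedFourGraph) where
  /-- the surface -/
  S : Type u
  /-- the complex -/
  K : Type u
  [topS : TopologicalSpace S]
  [t2S : T2Space S]
  [compactS : CompactSpace S]
  [chartedS : ChartedSpace (EuclideanHalfSpace 2) S]
  orientable : OrientableSurface S
  [topK : TopologicalSpace K]
  [t2K : T2Space K]
  f : S → K
  continuous_f : Continuous f
  surjective_f : Function.Surjective f
  standard : IsStandardMap f
  bdry : Γ.Circles → S
  isEmbedding_bdry : IsEmbedding bdry
  range_bdry : range bdry = (𝓡∂ 2).boundary S
  bdry_glue : ∀ a b, f (bdry a) = f (bdry b) ↔ Γ.SamePoint a b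

attribute [instance] StandardComplex.topS StandardComplex.t2S StandardComplex.compactS
  StandardComplex.chartedS StandardComplex.topK StandardComplex.t2K

namespace StandardComplex

variable {Γ : FramedFourGraph}

/-- The genus of the complex is the total genus of the surface. -/
def HasGenus (C : StandardComplex.{u} Γ) (g : ℕ) : Prop := HasTotalGenus C.S g

def NoTriplePoints (C : StandardComplex.{u} Γ) : Prop := ∀ y, ¬ IsTriplePoint C.f y

def NoCusps (C : StandardComplex.{u} Γ) : Prop := ∀ y, ¬ IsCuspPoint C.f y

/-- The elementary case: neither cusps nor triple points. -/
def IsElementary (C : StandardComplex.{u} Γ) : Prop := C.NoCusps ∧ C.NoTriplePoints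

/-- No double line contains both a cusp and a point of the boundary graph. -/
def NoCuspBoundaryLines (C : StandardComplex.{u} Γ) : Prop :=
  ¬ ∃ L, IsDoubleLine C.f L ∧ (∃ y ∈ L, IsCuspPoint C.f y) ∧ ∃ a, C.f (C.bdry a) ∈ L

/-- The surfaces of the two complexes have corresponding connected components, with corresponding
components bounded by the same circles of `Γ`. -/
def SameComponents (C : StandardComplex.{u} Γ) (C' : StandardComplex.{u} Γ) : Prop :=
  ∃ e : ConnectedComponents C.S ≃ ConnectedComponents C'.S,
    ∀ a, e (C.bdry a : ConnectedComponents C.S) = (C'.bdry a : ConnectedComponents C'.S)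

end StandardComplex

/-- A cobordism between `Γ₁` and `Γ₂`: a standard complex with boundary `Γ₁ ⊔ Γ₂`. -/
abbrev Cobordism (Γ₁ Γ₂ : FramedFourGraph) : Type (u + 1) :=
  StandardComplex.{u} (Γ₁.disjUnion Γ₂)

/-! The surface is kept and only the gluing changes: `K` is cut open along double lines through
cusps. Without triple points every fibre of `f` has at most two points, so any symmetric set of
double pairs, together with the diagonal, is an equivalence relation on the surface. Let `T` be the
closed set `doublePairs f`. Its diagonal points lie over cusps (`isCuspPoint_of_diag_mem`), so by
hypothesis no component of `T` contains both a diagonal point and a pair of boundary points.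

In a compact Hausdorff space such closed sets are separated by a clopen set. Hence `T` splits into
disjoint closed parts `B`, containing the diagonal points, and `G`, symmetric and containing the
boundary pairs (`exists_symmetric_splitting`); no finiteness or manifold structure of the double
lines is needed. The new complex is the quotient of the surface by `G`. As `B` and `G` are closed
and disjoint, near each crossing either the whole double line stays glued or the sheets come apart,
and a neighbourhood of each old cusp becomes a plane (`IsSplitting.isStandardMap`). A new cusp would
put a diagonal point into `G`. Surface and boundary identification are unchanged, so genus and
components are the same. -/

/-! ### Topological preliminaries -/

/-- The quotient of a compact Hausdorff space by a closed equivalence relation is Hausdorff. -/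
theorem t2Space_quotient_of_isClosed {S : Type*} [TopologicalSpace S] [T2Space S] [CompactSpace S]
    (r : Setoid S) (hr : IsClosed {p : S × S | r p.1 p.2}) : T2Space (Quotient r) := by
  -- The saturation of a closed set is the projection of a compact subset of the graph of `r`.
  have hcl : IsClosedMap (Quotient.mk r) := by
    intro c hc
    rw [← isQuotientMap_quotient_mk'.isClosed_preimage]
    have : (Quotient.mk' : S → Quotient r) ⁻¹' (Quotient.mk r '' c) =
        Prod.snd '' ({p : S × S | r p.1 p.2} ∩ Prod.fst ⁻¹' c) := by
      ext x
      constructor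
      · rintro ⟨z, hz, h⟩
        exact ⟨(z, x), ⟨Quotient.exact h, hz⟩, rfl⟩
      · rintro ⟨⟨z, x⟩, ⟨h, hz⟩, rfl⟩
        exact ⟨z, hz, Quotient.sound h⟩
    rw [this]
    exact ((hr.inter (hc.preimage continuous_fst)).isCompact.image continuous_snd).isClosed
  -- Properness, unlike closedness, passes to products. The product map is therefore closed and
  -- sends the graph of `r` onto the diagonal.
  have hprop : IsProperMap (Quotient.mk r) := by
    refine isProperMap_iff_isClosedMap_and_compact_fibers.2
      ⟨continuous_quotient_mk', hcl, fun y => ?_⟩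
    obtain ⟨x, rfl⟩ := Quotient.exists_rep y
    have := hcl {x} isClosed_singleton
    rw [image_singleton] at this
    exact (this.preimage continuous_quotient_mk').isCompact
  rw [t2_iff_isClosed_diagonal]
  have := (hprop.prodMap hprop).isClosedMap _ hr
  convert this
  ext ⟨a, b⟩
  constructor
  · rintro h
    obtain rfl : a = b := h
    obtain ⟨x, rfl⟩ := Quotient.exists_rep a
    exact ⟨(x, x), r.refl x, rfl⟩
  · rintro ⟨⟨x, z⟩, h, he⟩
    simp only [Prod.map_apply, Prod.mk.injEq] at he
    rw [mem_diagonal_iff, ← he.1, ← he.2]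
    exact Quotient.sound h

/-- Two quotient maps with the same fibres have homeomorphic targets. -/
theorem Topology.IsQuotientMap.exists_homeomorph {X Y Z : Type*} [TopologicalSpace X]
    [TopologicalSpace Y] [TopologicalSpace Z] {α : X → Y} {β : X → Z} (hα : IsQuotientMap α)
    (hβ : IsQuotientMap β) (h : ∀ a b, α a = α b ↔ β a = β b) :
    ∃ ψ : Y ≃ₜ Z, ∀ x, ψ (α x) = β x := by
  obtain ⟨s, hs⟩ := hα.surjective.hasRightInverse
  have hg : ∀ x, β (s (α x)) = β x := fun x => (h _ _).1 (hs _)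
  have hgq : IsQuotientMap (β ∘ s) := by
    refine hα.of_comp_isQuotientMap ?_
    convert hβ
    exact funext hg
  have hgi : Function.Injective (β ∘ s) := fun y z hyz => by
    rw [← hs y, ← hs z]
    exact (h _ _).2 hyz
  exact ⟨(isHomeomorph_iff_isQuotientMap_injective.2 ⟨hgq, hgi⟩).homeomorph, hg⟩

/-- In a compact Hausdorff space, two closed sets that meet no common connected component are
separated by a clopen set. -/
theorem exists_isClopen_separating {X : Type*} [TopologicalSpace X] [T2Space X] [CompactSpace X]
    {A E : Set X} (hA : IsClosed A) (hE : IsClosed E)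
    (h : ∀ a ∈ A, ∀ e ∈ E, connectedComponent a ≠ connectedComponent e) :
    ∃ Z : Set X, IsClopen Z ∧ A ⊆ Z ∧ Disjoint Z E := by
  have hc : Continuous ((↑) : X → ConnectedComponents X) := ConnectedComponents.continuous_coe
  -- The space of components is compact, Hausdorff and totally disconnected, so clopen sets separate
  -- the disjoint closed images of `A` and `E`.
  obtain ⟨C, hC, hAC, hCE⟩ := exists_clopen_of_closed_subset_open
    (hA.isCompact.image hc).isClosed (hE.isCompact.image hc).isClosed.isOpen_compl (by
      rintro _ ⟨a, ha, rfl⟩ ⟨e, he, hae⟩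
      exact h a ha e he (ConnectedComponents.coe_eq_coe.1 hae.symm))
  refine ⟨_, hC.preimage hc, fun a ha => hAC ⟨a, ha, rfl⟩, ?_⟩
  rw [Set.disjoint_left]
  exact fun x hx hxE => hCE hx ⟨x, hxE, rfl⟩

/-- A compact symmetric relation `T` is split into two closed symmetric parts, one containing `A`
and one containing `E`, if no component of `T` meets both `A` and `E`. -/
theorem exists_symmetric_splitting {S : Type*} [TopologicalSpace S] [T2Space S] [CompactSpace S]
    {T A E : Set (S × S)} (hT : IsClosed T) (hA : IsClosed A) (hE : IsClosed E)
    (hTs : ∀ p ∈ T, p.swap ∈ T) (hEs : ∀ p ∈ E, p.swap ∈ E)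
    (h : ∀ a ∈ T, a ∈ A → ∀ e ∈ E, e ∉ connectedComponentIn T a) :
    ∃ B G : Set (S × S), IsClosed B ∧ IsClosed G ∧ B ∪ G = T ∧ Disjoint B G ∧
      (∀ p ∈ G, p.swap ∈ G) ∧ T ∩ A ⊆ B ∧ T ∩ E ⊆ G := by
  have : CompactSpace T := isCompact_iff_compactSpace.1 hT.isCompact
  obtain ⟨Z, hZ, hAZ, hZE⟩ := exists_isClopen_separating
    (hA.preimage (continuous_subtype_val (p := (· ∈ T))))
    (hE.preimage (continuous_subtype_val (p := (· ∈ T)))) (by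
      intro a ha e he hae
      refine h a a.2 ha e he ?_
      rw [connectedComponentIn_eq_image a.2]
      exact ⟨e, hae ▸ mem_connectedComponent, rfl⟩)
  have hZc : IsClosed ((↑) '' Z : Set (S × S)) := hT.isClosedEmbedding_subtypeVal.isClosedMap _ hZ.1
  have hZc' : IsClosed ((↑) '' Zᶜ : Set (S × S)) :=
    hT.isClosedEmbedding_subtypeVal.isClosedMap _ hZ.compl.1
  have hmem : ∀ (Y : Set T) (p : S × S), p ∈ ((↑) '' Y : Set (S × S)) ↔ ∃ hp : p ∈ T, ⟨p, hp⟩ ∈ Y :=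
    fun Y p => by simp
  -- The clopen set `Z` need not be symmetric: `B` takes the pairs with either ordering in `Z`, `G`
  -- those with neither. Symmetry of `E` keeps it inside `G`.
  refine ⟨(↑) '' Z ∪ Prod.swap ⁻¹' ((↑) '' Z), (↑) '' Zᶜ ∩ Prod.swap ⁻¹' ((↑) '' Zᶜ),
    hZc.union (hZc.preimage continuous_swap), hZc'.inter (hZc'.preimage continuous_swap),
    ?_, ?_, ?_, ?_, ?_⟩
  · ext p
    simp only [mem_union, mem_inter_iff, mem_preimage, hmem, mem_compl_iff]
    constructor
    · rintro ((⟨hp, -⟩ | ⟨hp, -⟩) | ⟨⟨hp, -⟩, -⟩)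
      · exact hp
      · simpa using hTs _ hp
      · exact hp
    · intro hp
      have := hTs p hp
      by_cases h1 : (⟨p, hp⟩ : T) ∈ Z
      · exact Or.inl (Or.inl ⟨hp, h1⟩)
      by_cases h2 : (⟨p.swap, this⟩ : T) ∈ Z
      · exact Or.inl (Or.inr ⟨this, h2⟩)
      exact Or.inr ⟨⟨hp, h1⟩, ⟨this, h2⟩⟩
  · rw [Set.disjoint_left]
    intro p
    simp only [mem_union, mem_inter_iff, mem_preimage, hmem, mem_compl_iff]
    rintro (⟨hp, h1⟩ | ⟨hp, h1⟩) ⟨⟨hp', h2⟩, ⟨hp'', h3⟩⟩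
    · exact h2 h1
    · exact h3 h1
  · rintro p ⟨h1, h2⟩
    exact ⟨h2, by simpa using h1⟩
  · rintro p ⟨hp, hpA⟩
    exact Or.inl ⟨⟨p, hp⟩, hAZ hpA, rfl⟩
  · rintro p ⟨hp, hpE⟩
    exact ⟨⟨⟨p, hp⟩, fun hz => Set.disjoint_left.1 hZE hz hpE, rfl⟩,
      ⟨⟨p.swap, hTs p hp⟩, fun hz => Set.disjoint_left.1 hZE hz (hEs p hpE), rfl⟩⟩

/-! ### Charts of a pasting map -/

/-- `σ` parametrizes an open set of `S` that is saturated for `q`, and turns the gluing by `q` into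
the gluing by the model map `m`. -/
def IsModelChart {S K X : Type*} [TopologicalSpace S] [TopologicalSpace X] (q : S → K)
    (m : X → ℝ × ℝ × ℝ) (σ : X → S) : Prop :=
  IsOpenEmbedding σ ∧ ∀ a z, q (σ a) = q z ↔ ∃ b, σ b = z ∧ m a = m b

section Charts

variable {S K X : Type*} [TopologicalSpace S] [TopologicalSpace K] [TopologicalSpace X]

/-- Moves the local form from the target to a gluing relation on the surface, where it can be
compared with that of another quotient of the same surface. -/
theorem IsModelledAt.exists_chart {f : S → K} {y : K} {m : X → ℝ × ℝ × ℝ}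
    (hf : Continuous f) (h : IsModelledAt f y m) :
    ∃ σ, IsModelChart f m σ ∧ ∃ o, m o = 0 ∧ f (σ o) = y := by
  obtain ⟨V, hy, hV, φ, ψ, hm, h0⟩ := h
  have hmσ : ∀ a : X, (ψ ⟨f (φ.symm a), (φ.symm a).2⟩ : ℝ × ℝ × ℝ) = m a := fun a => by
    rw [hm (φ.symm a), φ.apply_symm_apply]
  have hψ : ∀ v w : V, (ψ v : ℝ × ℝ × ℝ) = ψ w → (v : K) = w := fun v w hvw =>
    congrArg Subtype.val (ψ.injective (Subtype.ext hvw))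
  refine ⟨fun a => φ.symm a,
    ⟨(hV.preimage hf).isOpenEmbedding_subtypeVal.comp φ.symm.isOpenEmbedding, fun a z => ?_⟩, ?_⟩
  · constructor
    · intro h
      have hz : z ∈ f ⁻¹' V := by
        have := (φ.symm a).2
        simp only [mem_preimage] at this ⊢
        rwa [← h]
      refine ⟨φ ⟨z, hz⟩, by simp, ?_⟩
      rw [← hmσ a, ← hm ⟨z, hz⟩]
      congr 2
      exact Subtype.ext h
    · rintro ⟨b, rfl, hab⟩
      rw [← hmσ a, ← hmσ b] at hab
      exact hψ _ _ hab
  · obtain ⟨o, ho⟩ := (ψ ⟨y, hy⟩).2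
    rw [h0] at ho
    exact ⟨o, ho, hψ ⟨_, (φ.symm o).2⟩ ⟨y, hy⟩ (by rw [hmσ, ho, h0])⟩

/-- The homeomorphism of targets comes for free: over the saturated open set, `q` and `m` are
quotient maps of `X` with the same fibres. -/
theorem IsModelChart.isModelledAt {q : S → K} {m : X → ℝ × ℝ × ℝ} {σ : X → S}
    (hq : IsQuotientMap q) (hm : IsQuotientMap (rangeFactorization m)) (h : IsModelChart q m σ)
    {o : X} (ho : m o = 0) : IsModelledAt q (q (σ o)) m := by
  have hpre : q ⁻¹' (q '' range σ) = range σ := by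
    refine Subset.antisymm ?_ (subset_preimage_image _ _)
    rintro z ⟨_, ⟨a, rfl⟩, hz⟩
    obtain ⟨b, hb, -⟩ := (h.2 a z).1 hz
    exact ⟨b, hb⟩
  have hV : IsOpen (q '' range σ) := by
    rw [← hq.isOpen_preimage, hpre]
    exact h.1.isOpen_range
  let φ : (q ⁻¹' (q '' range σ)) ≃ₜ X :=
    (Homeomorph.setCongr hpre).trans h.1.isEmbedding.toHomeomorph.symm
  have hφ : ∀ x, σ (φ x) = x := fun x =>
    congrArg Subtype.val (h.1.isEmbedding.toHomeomorph.apply_symm_apply (Homeomorph.setCongr hpre x))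
  have hα : IsQuotientMap ((q '' range σ).restrictPreimage q ∘ φ.symm) :=
    (hq.restrictPreimage_isOpen hV).comp φ.symm.isQuotientMap
  have hαv : ∀ a, ((((q '' range σ).restrictPreimage q ∘ φ.symm) a : q '' range σ) : K) = q (σ a) :=
    fun a => by
      have := hφ (φ.symm a)
      rw [φ.apply_symm_apply] at this
      simp [this]
  have hker : ∀ a b, ((q '' range σ).restrictPreimage q ∘ φ.symm) a =
      ((q '' range σ).restrictPreimage q ∘ φ.symm) b ↔
      rangeFactorization m a = rangeFactorization m b := fun a b => by
    rw [Subtype.ext_iff, hαv, hαv, h.2 a (σ b), Subtype.ext_iff]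
    simp only [rangeFactorization_coe]
    constructor
    · rintro ⟨c, hc, hac⟩
      rw [hac, h.1.injective hc]
    · exact fun hab => ⟨b, rfl, hab⟩
  obtain ⟨ψ, hψ⟩ := hα.exists_homeomorph hm hker
  have hψ' : ∀ (v : q '' range σ) (a : X), (v : K) = q (σ a) → (ψ v : ℝ × ℝ × ℝ) = m a := fun v a hv => by
    rw [← rangeFactorization_coe m a, ← hψ a]
    congr 2
    exact Subtype.ext (hv.trans (hαv a).symm)
  refine ⟨q '' range σ, ⟨σ o, ⟨o, rfl⟩, rfl⟩, hV, φ, ψ, fun x => ?_, ?_⟩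
  · exact hψ' _ _ (by rw [hφ])
  · rw [hψ' _ o rfl, ho]

end Charts

/-! ### Models -/

theorem isQuotientMap_rangeFactorization {X Y : Type*} [TopologicalSpace X] [TopologicalSpace Y]
    {m : X → Y} (hm : Continuous m) (hc : IsClosedMap m) :
    IsQuotientMap (rangeFactorization m) := by
  refine IsClosedMap.isQuotientMap ?_ hm.rangeFactorization rangeFactorization_surjective
  exact hc.codRestrict _

namespace LocalModel

theorem isClosedEmbedding_sheet : IsClosedEmbedding sheet :=
  Function.LeftInverse.isClosedEmbedding (f := fun x : ℝ × ℝ × ℝ => (x.1, x.2.1))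
    (fun _ => rfl) (by fun_prop) (by unfold sheet; fun_prop)

theorem isClosedEmbedding_transverseSheet :
    IsClosedEmbedding (fun p : ℝ × ℝ => (p.1, (0 : ℝ), p.2)) :=
  Function.LeftInverse.isClosedEmbedding (f := fun x : ℝ × ℝ × ℝ => (x.1, x.2.2))
    (fun _ => rfl) (by fun_prop) (by fun_prop)

theorem isClosedEmbedding_halfPlane_val : IsClosedEmbedding (Subtype.val : HalfPlane → ℝ × ℝ) :=
  (isClosed_le continuous_const continuous_fst).isClosedEmbedding_subtypeVal

/-- A model sheet, with a base point mapped to the origin. -/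
structure IsSheet {X : Type*} [TopologicalSpace X] (m : X → ℝ × ℝ × ℝ) (o : X) : Prop where
  isQuotientMap : IsQuotientMap (rangeFactorization m)
  injective : Function.Injective m
  map_base : m o = 0

/-- Two copies of a model sheet that cross along the line `l` through the base point. -/
structure IsCrossing {X : Type*} [TopologicalSpace X] (m : X ⊕ X → ℝ × ℝ × ℝ) (o : X) (l : Set X) :
    Prop where
  isQuotientMap : IsQuotientMap (rangeFactorization m)
  inl_iff : ∀ a b, m (Sum.inl a) = m (Sum.inl b) ↔ a = b
  inr_iff : ∀ a b, m (Sum.inr a) = m (Sum.inr b) ↔ a = b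
  inl_inr_iff : ∀ a b, m (Sum.inl a) = m (Sum.inr b) ↔ a = b ∧ a ∈ l
  map_base : m (Sum.inl o) = 0
  base_mem : o ∈ l

/-- The space can be shrunk into any neighbourhood of the base point, preserving the line `l`. -/
def Shrinkable (X : Type*) [TopologicalSpace X] (o : X) (l : Set X) : Prop :=
  ∀ N ∈ 𝓝 o, ∃ e : X → X, IsOpenEmbedding e ∧ range e ⊆ N ∧ e o = o ∧ ∀ a, e a ∈ l ↔ a ∈ l

/-- `ℝ` shrinks into any interval around `0`, preserving the sign. -/
theorem exists_shrink_real {ε : ℝ} (hε : 0 < ε) :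
    ∃ k : ℝ → ℝ, IsOpenEmbedding k ∧ (∀ t, |k t| < ε) ∧ (∀ t, k t = 0 ↔ t = 0) ∧
      ∀ t, 0 ≤ k t ↔ 0 ≤ t := by
  have hc : 0 < ε / 2 := by positivity
  have hmono : StrictMono (fun t => ε / 2 * Real.arctan t) := fun a b hab =>
    mul_lt_mul_of_pos_left (Real.arctan_strictMono hab) hc
  have h0 : (fun t => ε / 2 * Real.arctan t) 0 = 0 := by simp
  -- The factor `ε / 2` suffices because `|arctan t| < π / 2 < 2`.
  refine ⟨fun t => ε / 2 * Real.arctan t, ?_, fun t => ?_, fun t => ?_, fun t => ?_⟩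
  · exact (Homeomorph.mulLeft₀ (ε / 2) hc.ne').isOpenEmbedding.comp
      (isOpen_Ioo.isOpenEmbedding_subtypeVal.comp
        Real.tanOrderIso.symm.toHomeomorph.isOpenEmbedding)
  · have h1 := Real.arctan_lt_pi_div_two t
    have h2 := Real.neg_pi_div_two_lt_arctan t
    have h3 := Real.pi_lt_four
    rw [abs_lt]
    constructor <;> nlinarith
  · simp [hc.ne', Real.arctan_eq_zero_iff]
  · simpa only [h0] using hmono.le_iff_le (a := 0) (b := t)

theorem shrinkable_plane : Shrinkable (ℝ × ℝ) 0 {p | p.2 = 0} := by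
  intro N hN
  obtain ⟨ε, hε, hball⟩ := Metric.mem_nhds_iff.1 hN
  obtain ⟨k, hk, hlt, h0, -⟩ := exists_shrink_real hε
  refine ⟨Prod.map k k, hk.prodMap hk, ?_, ?_, fun a => h0 _⟩
  · rintro _ ⟨p, rfl⟩
    refine hball ?_
    simp [Prod.norm_def, hlt]
  · simp [Prod.ext_iff, h0]

/-- The origin of the half-plane. -/
def HalfPlane.origin : HalfPlane := ⟨0, le_rfl⟩

theorem shrinkable_halfPlane : Shrinkable HalfPlane HalfPlane.origin {p | p.1.2 = 0} := by
  intro N hN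
  obtain ⟨ε, hε, hball⟩ := Metric.mem_nhds_iff.1 hN
  obtain ⟨k, hk, hlt, h0, hpos⟩ := exists_shrink_real hε
  -- Since `k` preserves signs, the half-plane is its own preimage, and an open embedding restricted
  -- to a preimage is again one.
  have hset : {p : ℝ × ℝ | 0 ≤ p.1} = Prod.map k k ⁻¹' {p : ℝ × ℝ | 0 ≤ p.1} := by
    ext p
    simp [hpos]
  refine ⟨({p : ℝ × ℝ | 0 ≤ p.1}.restrictPreimage (Prod.map k k)) ∘ Homeomorph.setCongr hset,
    ((hk.prodMap hk).restrictPreimage _).comp (Homeomorph.isOpenEmbedding _), ?_, ?_, fun a => h0 _⟩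
  · rintro _ ⟨p, rfl⟩
    refine hball ?_
    simp [Subtype.dist_eq, Prod.norm_def, hlt, HalfPlane.origin]
  · exact Subtype.ext (Prod.ext ((h0 0).2 rfl) ((h0 0).2 rfl))

theorem isSheet_sheet : IsSheet sheet 0 where
  isQuotientMap := isQuotientMap_rangeFactorization isClosedEmbedding_sheet.continuous
    isClosedEmbedding_sheet.isClosedMap
  injective := isClosedEmbedding_sheet.injective
  map_base := rfl

theorem isSheet_halfSheet : IsSheet halfSheet HalfPlane.origin :=
  have h := isClosedEmbedding_sheet.comp isClosedEmbedding_halfPlane_val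
  { isQuotientMap := isQuotientMap_rangeFactorization h.continuous h.isClosedMap
    injective := h.injective
    map_base := rfl }

theorem isCrossing_double : IsCrossing double 0 {p | p.2 = 0} where
  isQuotientMap := isQuotientMap_rangeFactorization
    (isClosedEmbedding_sheet.continuous.sumElim isClosedEmbedding_transverseSheet.continuous)
    (isClosedEmbedding_sheet.isClosedMap.sumElim isClosedEmbedding_transverseSheet.isClosedMap)
  inl_iff _ _ := isClosedEmbedding_sheet.injective.eq_iff
  inr_iff _ _ := isClosedEmbedding_transverseSheet.injective.eq_iff
  inl_inr_iff a b := by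
    simp only [double, Sum.elim_inl, Sum.elim_inr, Prod.ext_iff, mem_ofPred_eq]
    grind
  map_base := rfl
  base_mem := rfl

theorem isCrossing_halfDouble : IsCrossing halfDouble HalfPlane.origin {p | p.1.2 = 0} :=
  have h₁ := isClosedEmbedding_sheet.comp isClosedEmbedding_halfPlane_val
  have h₂ := isClosedEmbedding_transverseSheet.comp isClosedEmbedding_halfPlane_val
  { isQuotientMap := isQuotientMap_rangeFactorization (h₁.continuous.sumElim h₂.continuous)
      (h₁.isClosedMap.sumElim h₂.isClosedMap)
    inl_iff := fun _ _ => h₁.injective.eq_iff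
    inr_iff := fun _ _ => h₂.injective.eq_iff
    inl_inr_iff := fun a b => by
      simp only [halfDouble, Sum.elim_inl, Sum.elim_inr, Prod.ext_iff, mem_ofPred_eq, Subtype.ext_iff]
      grind
    map_base := rfl
    base_mem := rfl }

theorem cusp_eq_zero_iff {p : ℝ × ℝ} : cusp p = 0 ↔ p = 0 := by
  simp only [cusp, Prod.ext_iff, Prod.fst_zero, Prod.snd_zero]
  constructor
  · rintro ⟨h, -, h'⟩
    exact ⟨by simpa using h, h'⟩
  · rintro ⟨h, h'⟩
    simp [h, h']

theorem eq_or_eq_of_cusp_eq {p p' : ℝ × ℝ} (h : cusp p = cusp p') : p = p' ∨ p' = (-p.1, p.2) := by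
  simp only [cusp, Prod.ext_iff] at h ⊢
  obtain ⟨h₁, -, h₃⟩ := h
  rcases sq_eq_sq_iff_eq_or_eq_neg.1 h₁ with h | h
  · exact Or.inl ⟨h, h₃⟩
  · exact Or.inr ⟨by linarith, h₃.symm⟩

namespace IsCrossing

variable {X : Type*} [TopologicalSpace X] {m : X ⊕ X → ℝ × ℝ × ℝ} {o : X} {l : Set X}

theorem map_inr_base (h : IsCrossing m o l) : m (Sum.inr o) = 0 := by
  rw [← (h.inl_inr_iff o o).2 ⟨rfl, h.base_mem⟩, h.map_base]

theorem eq_of_map_eq_zero (h : IsCrossing m o l) {s : X ⊕ X} (hs : m s = 0) :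
    s = Sum.inl o ∨ s = Sum.inr o := by
  rcases s with a | a
  · exact Or.inl (congrArg _ ((h.inl_iff _ _).1 (hs.trans h.map_base.symm)))
  · exact Or.inr (congrArg _ ((h.inr_iff _ _).1 (hs.trans h.map_inr_base.symm)))

end IsCrossing

end LocalModel

/-! ### Double points of a standard map without triple points -/

open LocalModel

section Ungluing

variable {S K K' X : Type*} [TopologicalSpace S] [TopologicalSpace K']
  [TopologicalSpace X]

theorem eq_of_mem_doublePairs [TopologicalSpace K] [T2Space K] {f : S → K} (hf : Continuous f) {p : S × S}
    (hp : p ∈ doublePairs f) : f p.1 = f p.2 :=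
  closure_minimal (fun _ h => h.2)
    (isClosed_eq (hf.comp continuous_fst) (hf.comp continuous_snd)) hp

theorem swap_mem_doublePairs {f : S → K} {p : S × S} (hp : p ∈ doublePairs f) :
    p.swap ∈ doublePairs f := by
  have : doublePairs f ⊆ Prod.swap ⁻¹' doublePairs f :=
    closure_minimal (fun p h => subset_closure ⟨h.1.symm, h.2.symm⟩)
      (isClosed_closure.preimage continuous_swap)
  exact this hp

/-- No pair of double points converges to a point near which the map is injective. -/
theorem diag_notMem_doublePairs {f : S → K} {τ : X → S} (hτ : IsOpenEmbedding τ)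
    (hinj : Function.Injective (f ∘ τ)) (a : X) : (τ a, τ a) ∉ doublePairs f := by
  intro h
  have hN : range τ ∈ 𝓝 (τ a) := hτ.isOpen_range.mem_nhds ⟨a, rfl⟩
  obtain ⟨p, ⟨⟨b, hb⟩, ⟨c, hc⟩⟩, hne, hp⟩ := mem_closure_iff_nhds.1 h _ (prod_mem_nhds hN hN)
  rw [← hb, ← hc] at hp
  exact hne (by rw [← hb, ← hc, hinj hp])

theorem IsModelChart.comp_injective {f : S → K} {m : X → ℝ × ℝ × ℝ} {σ : X → S}
    (h : IsModelChart f m σ) {W : Type*} {i : W → X} (hi : Function.Injective (m ∘ i)) :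
    Function.Injective (f ∘ σ ∘ i) := by
  intro a b hab
  obtain ⟨c, hc, hac⟩ := (h.2 (i a) (σ (i b))).1 hab
  rw [h.1.injective hc] at hac
  exact hi hac

theorem LocalModel.IsSheet.diag_notMem [TopologicalSpace K] {f : S → K} (hf : Continuous f) {m : X → ℝ × ℝ × ℝ} {o : X}
    (hm : IsSheet m o) {c : S} (h : IsModelledAt f (f c) m) : (c, c) ∉ doublePairs f := by
  obtain ⟨σ, hσ, a, -, hac⟩ := h.exists_chart hf
  obtain ⟨b, rfl, -⟩ := (hσ.2 _ _).1 hac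
  exact diag_notMem_doublePairs hσ.1 (hσ.comp_injective (i := id) hm.injective) b

/-- Each sheet is open in the source and injective by itself; only points on different sheets are
glued. -/
theorem LocalModel.IsCrossing.diag_notMem [TopologicalSpace K] {f : S → K} (hf : Continuous f) {m : X ⊕ X → ℝ × ℝ × ℝ}
    {o : X} {l : Set X} (hm : IsCrossing m o l) {c : S} (h : IsModelledAt f (f c) m) :
    (c, c) ∉ doublePairs f := by
  obtain ⟨σ, hσ, a, -, hac⟩ := h.exists_chart hf
  obtain ⟨b | b, rfl, -⟩ := (hσ.2 _ _).1 hac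
  · exact diag_notMem_doublePairs (hσ.1.comp IsOpenEmbedding.inl)
      (hσ.comp_injective (i := Sum.inl) fun _ _ => (hm.inl_iff _ _).1) b
  · exact diag_notMem_doublePairs (hσ.1.comp IsOpenEmbedding.inr)
      (hσ.comp_injective (i := Sum.inr) fun _ _ => (hm.inr_iff _ _).1) b

/-- Pairs of double points converge to the diagonal only over cusps. -/
theorem isCuspPoint_of_diag_mem [TopologicalSpace K] {f : S → K} (hf : Continuous f) (hst : IsStandardMap f)
    (htr : ∀ y, ¬ IsTriplePoint f y) {c : S} (hc : (c, c) ∈ doublePairs f) :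
    IsCuspPoint f (f c) := by
  rcases hst (f c) with h | h | h | h | h | h
  · exact absurd hc (isSheet_sheet.diag_notMem hf h)
  · exact absurd hc (isCrossing_double.diag_notMem hf h)
  · exact absurd h (htr _)
  · exact h
  · exact absurd hc (isSheet_halfSheet.diag_notMem hf h)
  · exact absurd hc (isCrossing_halfDouble.diag_notMem hf h)

/-- No three distinct points are glued together. -/
def FibersAtMostTwo (f : S → K) : Prop :=
  ∀ a b c, f a = f b → f a = f c → a = b ∨ b = c ∨ a = c

theorem IsModelChart.exists_of_map_eq {f : S → K} {m : X → ℝ × ℝ × ℝ} {σ : X → S}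
    (hσ : IsModelChart f m σ) {o : X} (ho : m o = 0) {a : S} (ha : f (σ o) = f a) :
    ∃ s, σ s = a ∧ m s = 0 := by
  obtain ⟨s, hs, h⟩ := (hσ.2 _ _).1 ha
  exact ⟨s, hs, h.symm.trans ho⟩

theorem fibersAtMostTwo [TopologicalSpace K] {f : S → K} (hf : Continuous f) (hst : IsStandardMap f)
    (htr : ∀ y, ¬ IsTriplePoint f y) : FibersAtMostTwo f := by
  -- The fibre corresponds to the zeros of the model, at most two outside the triple model. For a
  -- model with a single zero, `q` is an arbitrary filler.
  have key : ∀ {X : Type} [TopologicalSpace X] {m : X → ℝ × ℝ × ℝ} {p q : X}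
      (_ : ∀ s, m s = 0 → s = p ∨ s = q) (a b c : S), IsModelledAt f (f a) m →
      f a = f b → f a = f c → a = b ∨ b = c ∨ a = c := by
    intro X _ m p q hm a b c h hab hac
    obtain ⟨σ, hσ, o, ho, hoa⟩ := h.exists_chart hf
    obtain ⟨s, rfl, hs⟩ := hσ.exists_of_map_eq ho hoa
    obtain ⟨t, rfl, ht⟩ := hσ.exists_of_map_eq ho (hoa.trans hab)
    obtain ⟨u, rfl, hu⟩ := hσ.exists_of_map_eq ho (hoa.trans hac)
    rcases hm s hs with rfl | rfl <;> rcases hm t ht with rfl | rfl <;>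
      rcases hm u hu with rfl | rfl <;> simp
  intro a b c hab hac
  rcases hst (f a) with h | h | h | h | h | h
  · exact key (fun s hs => Or.inl (isSheet_sheet.injective (hs.trans isSheet_sheet.map_base.symm)))
      a b c h hab hac (q := 0)
  · exact key (fun s => isCrossing_double.eq_of_map_eq_zero) a b c h hab hac
  · exact absurd h (htr _)
  · exact key (fun s hs => Or.inl (cusp_eq_zero_iff.1 hs)) a b c h hab hac (q := 0)
  · exact key (fun s hs => Or.inl (isSheet_halfSheet.injective
      (hs.trans isSheet_halfSheet.map_base.symm))) a b c h hab hac (q := HalfPlane.origin)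
  · exact key (fun s => isCrossing_halfDouble.eq_of_map_eq_zero) a b c h hab hac

/-- A map with at most two-point fibres has no triple points. -/
theorem FibersAtMostTwo.not_isTriplePoint [TopologicalSpace K] {f : S → K} (hf : Continuous f) (h : FibersAtMostTwo f)
    (y : K) : ¬ IsTriplePoint f y := by
  intro hy
  obtain ⟨σ, hσ, -⟩ := hy.exists_chart hf
  have h₁ : f (σ (Sum.inl 0)) = f (σ (Sum.inr (Sum.inl 0))) :=
    (hσ.2 _ _).2 ⟨_, rfl, by simp [triple]⟩
  have h₂ : f (σ (Sum.inl 0)) = f (σ (Sum.inr (Sum.inr 0))) :=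
    (hσ.2 _ _).2 ⟨_, rfl, by simp [triple]⟩
  rcases h _ _ _ h₁ h₂ with h | h | h <;> simpa using hσ.1.injective h

/-! ### Ungluing part of the double points -/

/-- The double points of `f` are divided into closed parts `B` and `G`, of which `G` is symmetric
and contains no limit of double points on the diagonal. -/
structure IsSplitting (f : S → K) (B G : Set (S × S)) : Prop where
  isClosed_left : IsClosed B
  isClosed_right : IsClosed G
  union_eq : B ∪ G = doublePairs f
  disjoint : Disjoint B G
  swap_mem : ∀ p ∈ G, p.swap ∈ G
  diag_notMem : ∀ c, (c, c) ∉ G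

namespace IsSplitting

variable {f : S → K} {B G : Set (S × S)}

theorem ne (h : IsSplitting f B G) {x z : S} (hp : (x, z) ∈ G) : x ≠ z := by
  rintro rfl
  exact h.diag_notMem _ hp

theorem map_eq [TopologicalSpace K] [T2Space K] (h : IsSplitting f B G) (hf : Continuous f) {x z : S}
    (hp : (x, z) ∈ G) : f x = f z :=
  eq_of_mem_doublePairs hf (h.union_eq ▸ Or.inr hp : (x, z) ∈ doublePairs f)

theorem mem_or_mem (h : IsSplitting f B G) {x z : S} (hne : x ≠ z) (hxz : f x = f z) :
    (x, z) ∈ B ∨ (x, z) ∈ G := by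
  have : (x, z) ∈ doublePairs f := subset_closure ⟨hne, hxz⟩
  rwa [← h.union_eq] at this

/-- The equivalence relation on the surface that glues only the pairs in `G`. -/
def setoid [TopologicalSpace K] [T2Space K] (h : IsSplitting f B G) (hf : Continuous f) (h2 : FibersAtMostTwo f) :
    Setoid S where
  r x z := x = z ∨ (x, z) ∈ G
  iseqv :=
    { refl := fun _ => Or.inl rfl
      symm := by
        rintro x z (rfl | hp)
        · exact Or.inl rfl
        · exact Or.inr (h.swap_mem _ hp)
      trans := by
        rintro x z w (rfl | hp) (rfl | hp')
        · exact Or.inl rfl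
        · exact Or.inr hp'
        · exact Or.inr hp
        -- All three points lie in one fibre of `f`, so the outer two coincide.
        · have hxz := h.map_eq hf hp
          rcases h2 _ _ _ hxz (hxz.trans (h.map_eq hf hp')) with e | e | e
          · exact absurd e (h.ne hp)
          · exact absurd e (h.ne hp')
          · exact Or.inl e }

theorem isClosed_setoid [TopologicalSpace K] [T2Space S] [T2Space K] (h : IsSplitting f B G) (hf : Continuous f)
    (h2 : FibersAtMostTwo f) : IsClosed {p : S × S | h.setoid hf h2 p.1 p.2} := by
  have : {p : S × S | h.setoid hf h2 p.1 p.2} = diagonal S ∪ G := rfl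
  rw [this]
  exact isClosed_diagonal.union h.isClosed_right

variable {q : S → K'}

/-- An open set free of points occurring in `G` is saturated for `q`, which is injective on it. -/
theorem isModelledAt_sheet (hq : IsQuotientMap q) (hqG : ∀ x z, q x = q z ↔ x = z ∨ (x, z) ∈ G)
    {m : X → ℝ × ℝ × ℝ} {o : X} (hm : IsSheet m o) {τ : X → S} (hτ : IsOpenEmbedding τ)
    (hG : ∀ a z, (τ a, z) ∉ G) : IsModelledAt q (q (τ o)) m := by
  refine IsModelChart.isModelledAt hq hm.isQuotientMap ⟨hτ, fun a z => ?_⟩ hm.map_base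
  rw [hqG, or_iff_left (hG a z)]
  constructor
  · exact fun h => ⟨a, h, rfl⟩
  · rintro ⟨b, hb, h⟩
    rw [hm.injective h, hb]

theorem isModelledAt_of_sheet [TopologicalSpace K] [T2Space K] (h : IsSplitting f B G) (hf : Continuous f)
    (hq : IsQuotientMap q) (hqG : ∀ x z, q x = q z ↔ x = z ∨ (x, z) ∈ G)
    {m : X → ℝ × ℝ × ℝ} {o : X} (hm : IsSheet m o) {c : S} (hc : IsModelledAt f (f c) m) :
    IsModelledAt q (q c) m := by
  obtain ⟨σ, hσ, a, ha, hac⟩ := hc.exists_chart hf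
  obtain ⟨b, rfl, hb⟩ := hσ.exists_of_map_eq ha hac
  obtain rfl := hm.injective (hb.trans hm.map_base.symm)
  refine isModelledAt_sheet hq hqG hm hσ.1 fun a z hz => h.ne hz ?_
  obtain ⟨b, rfl, hab⟩ := (hσ.2 _ _).1 (h.map_eq hf hz)
  rw [hm.injective hab]

/-- Near a cusp the only double pairs are `(p.1, p.2)`, `(-p.1, p.2)`. They tend to a diagonal point
outside the closed set `G`, so a small enough disc has no gluing left. -/
theorem isModelledAt_of_cusp [TopologicalSpace K] [T2Space K] (h : IsSplitting f B G) (hf : Continuous f)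
    (hq : IsQuotientMap q) (hqG : ∀ x z, q x = q z ↔ x = z ∨ (x, z) ∈ G)
    {c : S} (hc : IsCuspPoint f (f c)) : IsModelledAt q (q c) sheet := by
  obtain ⟨σ, hσ, a, ha, hac⟩ := hc.exists_chart hf
  obtain ⟨b, rfl, hb⟩ := hσ.exists_of_map_eq ha hac
  obtain rfl := cusp_eq_zero_iff.1 hb
  have hσc := hσ.1.continuous
  have hN : {p : ℝ × ℝ | (σ p, σ (-p.1, p.2)) ∉ G} ∈ 𝓝 (0 : ℝ × ℝ) := by
    refine IsOpen.mem_nhds ?_ (by simpa [← Prod.zero_eq_mk] using h.diag_notMem (σ 0))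
    exact (h.isClosed_right.preimage (f := fun p : ℝ × ℝ => (σ p, σ (-p.1, p.2)))
      (by fun_prop)).isOpen_compl
  obtain ⟨e, he, heN, he0, -⟩ := shrinkable_plane _ hN
  have := isModelledAt_sheet hq hqG isSheet_sheet (hσ.1.comp he) fun a z hz => by
    obtain ⟨b, rfl, hab⟩ := (hσ.2 _ _).1 (h.map_eq hf hz)
    rcases eq_or_eq_of_cusp_eq hab with hb | rfl
    · exact h.ne hz (congrArg σ hb)
    · exact heN ⟨a, rfl⟩ hz
  rwa [Function.comp_apply, he0] at this

theorem isModelledAt_of_crossing [TopologicalSpace K] [T2Space K] (h : IsSplitting f B G) (hf : Continuous f)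
    (hq : IsQuotientMap q) (hqG : ∀ x z, q x = q z ↔ x = z ∨ (x, z) ∈ G)
    {m : X → ℝ × ℝ × ℝ} {n : X ⊕ X → ℝ × ℝ × ℝ} {o : X} {l : Set X} (hm : IsSheet m o)
    (hn : IsCrossing n o l) (hX : Shrinkable X o l) {c : S} (hc : IsModelledAt f (f c) n) :
    IsModelledAt q (q c) m ∨ IsModelledAt q (q c) n := by
  obtain ⟨σ, hσ, a, ha, hac⟩ := hc.exists_chart hf
  obtain ⟨s, rfl, hs⟩ := hσ.exists_of_map_eq ha hac
  have hpc : Continuous fun t : X => (σ (Sum.inl t), σ (Sum.inr t)) :=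
    (hσ.1.continuous.comp continuous_inl).prodMk (hσ.1.continuous.comp continuous_inr)
  have hinl : ∀ t u, f (σ (Sum.inl t)) = f (σ (Sum.inl u)) → t = u := fun t u htu =>
    hσ.comp_injective (i := Sum.inl) (fun _ _ => (hn.inl_iff _ _).1) htu
  have hinr : ∀ t u, f (σ (Sum.inr t)) = f (σ (Sum.inr u)) → t = u := fun t u htu =>
    hσ.comp_injective (i := Sum.inr) (fun _ _ => (hn.inr_iff _ _).1) htu
  have hlr : ∀ t u, f (σ (Sum.inl t)) = f (σ (Sum.inr u)) ↔ t = u ∧ t ∈ l := fun t u => by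
    rw [hσ.2, ← hn.inl_inr_iff]
    constructor
    · rintro ⟨b, hb, h⟩
      rwa [← hσ.1.injective hb]
    · exact fun h => ⟨_, rfl, h⟩
  have hne : ∀ t u, σ (Sum.inl t) ≠ σ (Sum.inr u) := fun t u htu => by
    simpa using hσ.1.injective htu
  -- If the central pair is in `G`, nearby pairs on the line avoid the closed set `B`, so all stay
  -- glued and the crossing survives. Otherwise nearby pairs avoid `G`, and the sheet through `c`
  -- alone is a chart.
  by_cases hG : (σ (Sum.inl o), σ (Sum.inr o)) ∈ G
  · right
    have hN : {t : X | (σ (Sum.inl t), σ (Sum.inr t)) ∉ B} ∈ 𝓝 o :=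
      (h.isClosed_left.preimage hpc).isOpen_compl.mem_nhds
        fun hB => Set.disjoint_left.1 h.disjoint hB hG
    obtain ⟨e, he, heN, he0, hel⟩ := hX _ hN
    have hmem : ∀ t u, (σ (Sum.inl (e t)), σ (Sum.inr (e u))) ∈ G ↔ t = u ∧ t ∈ l := fun t u => by
      constructor
      · intro hG
        have := (hlr _ _).1 (h.map_eq hf hG)
        exact ⟨he.injective this.1, (hel _).1 this.2⟩
      · rintro ⟨rfl, hl⟩
        exact (h.mem_or_mem (hne _ _) ((hlr _ _).2 ⟨rfl, (hel _).2 hl⟩)).resolve_left (heN ⟨t, rfl⟩)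
    have hee : IsOpenEmbedding (Sum.map e e) :=
      .of_continuous_injective_isOpenMap (he.continuous.sumMap he.continuous)
        (Sum.map_injective.2 ⟨he.injective, he.injective⟩) (he.isOpenMap.sumMap he.isOpenMap)
    have hσe : IsModelChart q n (σ ∘ Sum.map e e) := by
      refine ⟨hσ.1.comp hee, fun s z => ?_⟩
      rw [hqG]
      constructor
      · rintro (rfl | hz)
        · exact ⟨s, rfl, rfl⟩
        have hsz := h.map_eq hf hz
        obtain ⟨b, rfl, -⟩ := (hσ.2 _ _).1 hsz
        rcases s with a | a <;> rcases b with b | b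
        · exact absurd (congrArg (σ ∘ Sum.inl) (hinl _ _ hsz)) (h.ne hz)
        · obtain ⟨rfl, hl⟩ := (hlr _ _).1 hsz
          exact ⟨Sum.inr a, rfl, (hn.inl_inr_iff _ _).2 ⟨rfl, (hel _).1 hl⟩⟩
        · obtain ⟨rfl, hl⟩ := (hlr _ _).1 hsz.symm
          exact ⟨Sum.inl a, rfl, ((hn.inl_inr_iff _ _).2 ⟨rfl, (hel _).1 hl⟩).symm⟩
        · exact absurd (congrArg (σ ∘ Sum.inr) (hinr _ _ hsz)) (h.ne hz)
      · rintro ⟨t, rfl, hst⟩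
        rcases s with a | a <;> rcases t with b | b
        · rw [(hn.inl_iff _ _).1 hst]
          exact Or.inl rfl
        · exact Or.inr ((hmem _ _).2 ((hn.inl_inr_iff _ _).1 hst))
        · exact Or.inr (h.swap_mem _ ((hmem _ _).2 ((hn.inl_inr_iff _ _).1 hst.symm)))
        · rw [(hn.inr_iff _ _).1 hst]
          exact Or.inl rfl
    have hse : Sum.map e e s = s := by
      rcases hn.eq_of_map_eq_zero hs with rfl | rfl <;> simp [he0]
    have := hσe.isModelledAt hq hn.isQuotientMap hs
    rwa [Function.comp_apply, hse] at this
  · left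
    have hN : {t : X | (σ (Sum.inl t), σ (Sum.inr t)) ∉ G} ∈ 𝓝 o :=
      (h.isClosed_right.preimage hpc).isOpen_compl.mem_nhds hG
    obtain ⟨e, he, heN, he0, hel⟩ := hX _ hN
    rcases hn.eq_of_map_eq_zero hs with rfl | rfl
    · have := isModelledAt_sheet hq hqG hm (hσ.1.comp (IsOpenEmbedding.inl.comp he)) fun a z hz => by
        obtain ⟨b | b, rfl, -⟩ := (hσ.2 _ _).1 (h.map_eq hf hz)
        · exact h.ne hz (congrArg (σ ∘ Sum.inl) (hinl _ _ (h.map_eq hf hz)))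
        · obtain ⟨rfl, -⟩ := (hlr _ _).1 (h.map_eq hf hz)
          exact heN ⟨a, rfl⟩ hz
      simpa only [Function.comp_apply, he0] using this
    · have := isModelledAt_sheet hq hqG hm (hσ.1.comp (IsOpenEmbedding.inr.comp he)) fun a z hz => by
        obtain ⟨b | b, rfl, -⟩ := (hσ.2 _ _).1 (h.map_eq hf hz)
        · obtain ⟨rfl, -⟩ := (hlr _ _).1 (h.map_eq hf hz).symm
          exact heN ⟨a, rfl⟩ (h.swap_mem _ hz)
        · exact h.ne hz (congrArg (σ ∘ Sum.inr) (hinr _ _ (h.map_eq hf hz)))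
      simpa only [Function.comp_apply, he0] using this

/-- Ungluing makes a standard map without triple points standard. -/
theorem isStandardMap [TopologicalSpace K] [T2Space K] (h : IsSplitting f B G) (hf : Continuous f)
    (hst : IsStandardMap f) (htr : ∀ y, ¬ IsTriplePoint f y) (hq : IsQuotientMap q)
    (hqG : ∀ x z, q x = q z ↔ x = z ∨ (x, z) ∈ G) : IsStandardMap q := by
  intro y
  obtain ⟨c, rfl⟩ := hq.surjective y
  rcases hst (f c) with hc | hc | hc | hc | hc | hc
  · exact Or.inl (h.isModelledAt_of_sheet hf hq hqG isSheet_sheet hc)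
  · have := h.isModelledAt_of_crossing hf hq hqG isSheet_sheet isCrossing_double shrinkable_plane hc
    tauto
  · exact absurd hc (htr _)
  · exact Or.inl (h.isModelledAt_of_cusp hf hq hqG hc)
  · have := h.isModelledAt_of_sheet hf hq hqG isSheet_halfSheet hc
    tauto
  · have := h.isModelledAt_of_crossing hf hq hqG isSheet_halfSheet isCrossing_halfDouble
      shrinkable_halfPlane hc
    tauto

/-- At a cusp of `q` the pairs over `(t, 0)`, `(-t, 0)` with `t ≠ 0` would lie in `G`; letting `t →
0` gives a diagonal point of the closed set `G`. -/
theorem not_isCuspPoint (h : IsSplitting f B G) (hq : Continuous q)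
    (hqG : ∀ x z, q x = q z ↔ x = z ∨ (x, z) ∈ G) (y : K') : ¬ IsCuspPoint q y := by
  intro hy
  obtain ⟨σ, hσ, -⟩ := hy.exists_chart hq
  have hσc := hσ.1.continuous
  have hcl : IsClosed {t : ℝ | (σ (t, 0), σ (-t, 0)) ∈ G} :=
    h.isClosed_right.preimage (f := fun t : ℝ => (σ (t, 0), σ (-t, 0))) (by fun_prop)
  have hsub : ({0}ᶜ : Set ℝ) ⊆ {t : ℝ | (σ (t, 0), σ (-t, 0)) ∈ G} := by
    intro t ht
    refine ((hqG _ _).1 ((hσ.2 _ _).2 ⟨_, rfl, by simp [cusp]⟩)).resolve_left fun he => ht ?_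
    have := congrArg Prod.fst (hσ.1.injective he)
    simp only [mem_singleton_iff]
    simp only at this
    linarith
  have h0 := hcl.closure_subset_iff.2 hsub ((dense_compl_singleton (0 : ℝ)) 0)
  exact h.diag_notMem (σ (0, 0)) (by simpa using h0)

end IsSplitting

end Ungluing

/-! ### Construction of the elementary cobordism -/

theorem mainTheorem6 (Γ₁ Γ₂ : FramedFourGraph) (g : ℕ) (C : Cobordism.{u} Γ₁ Γ₂)
    (hg : C.HasGenus g) (htriple : C.NoTriplePoints) (hcusp : C.NoCuspBoundaryLines) :
    ∃ C' : Cobordism.{u} Γ₁ Γ₂,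
      C'.IsElementary ∧ (∃ g' ≤ g, C'.HasGenus g') ∧ C.SameComponents C' := by
  have hf := C.continuous_f
  have h2 := fibersAtMostTwo hf C.standard htriple
  have : Finite (Γ₁.disjUnion Γ₂).ι := (Γ₁.disjUnion Γ₂).finite_ι
  have hR : IsClosed (range C.bdry) :=
    (isCompact_range C.isEmbedding_bdry.continuous).isClosed
  obtain ⟨B, G, hB, hG, hBG, hdisj, hsymm, hBdiag, hGbd⟩ :=
    exists_symmetric_splitting (T := doublePairs C.f) (A := diagonal C.S)
      (E := range C.bdry ×ˢ range C.bdry) isClosed_closure isClosed_diagonal (hR.prod hR)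
      (fun _ => swap_mem_doublePairs) (fun _ hp => ⟨hp.2, hp.1⟩) (by
        -- A component containing both a diagonal point and a boundary pair would give a double line
        -- through a cusp and a boundary point.
        rintro ⟨c, c'⟩ hcT hcc ⟨x, x'⟩ ⟨⟨a, rfl⟩, -⟩ hx
        obtain rfl : c = c' := hcc
        exact hcusp ⟨_, ⟨_, hcT, rfl⟩, ⟨_, ⟨_, mem_connectedComponentIn hcT, rfl⟩,
          isCuspPoint_of_diag_mem hf C.standard htriple hcT⟩, a, ⟨_, hx, rfl⟩⟩)
  have h : IsSplitting C.f B G :=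
    { isClosed_left := hB
      isClosed_right := hG
      union_eq := hBG
      disjoint := hdisj
      swap_mem := hsymm
      diag_notMem := fun c hc => Set.disjoint_left.1 hdisj
        (hBdiag ⟨hBG ▸ Or.inr hc, rfl⟩) hc }
  have hqG : ∀ x z, Quotient.mk (h.setoid hf h2) x = Quotient.mk (h.setoid hf h2) z ↔
      x = z ∨ (x, z) ∈ G := fun x z => Quotient.eq
  have hq : IsQuotientMap (Quotient.mk (h.setoid hf h2)) := isQuotientMap_quotient_mk'
  have hqf : ∀ x z, Quotient.mk (h.setoid hf h2) x = Quotient.mk (h.setoid hf h2) z →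
      C.f x = C.f z := fun x z hxz => by
    rcases (hqG x z).1 hxz with rfl | hp
    · rfl
    · exact h.map_eq hf hp
  have : T2Space (Quotient (h.setoid hf h2)) :=
    t2Space_quotient_of_isClosed _ (h.isClosed_setoid hf h2)
  let C' : Cobordism.{u} Γ₁ Γ₂ :=
    { S := C.S
      K := Quotient (h.setoid hf h2)
      orientable := C.orientable
      f := Quotient.mk (h.setoid hf h2)
      continuous_f := hq.continuous
      surjective_f := hq.surjective
      standard := h.isStandardMap hf C.standard htriple hq hqG
      bdry := C.bdry
      isEmbedding_bdry := C.isEmbedding_bdry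
      range_bdry := C.range_bdry
      bdry_glue := fun a b => by
        rw [← C.bdry_glue]
        refine ⟨hqf _ _, fun hab => (hqG _ _).2 ?_⟩
        -- Distinct boundary points glued by `f` form a pair in `G`, so ungluing leaves the boundary
        -- graph intact.
        by_cases he : C.bdry a = C.bdry b
        · exact Or.inl he
        · exact Or.inr (hGbd ⟨subset_closure ⟨he, hab⟩, ⟨a, rfl⟩, ⟨b, rfl⟩⟩) }
  refine ⟨C', ⟨h.not_isCuspPoint hq.continuous hqG, ?_⟩, ⟨g, le_rfl, hg⟩, Equiv.refl _,
    fun _ => rfl⟩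
  -- Fibres of the new map are contained in fibres of `f`.
  exact FibersAtMostTwo.not_isTriplePoint hq.continuous fun a b c hab hac =>
    h2 a b c (hqf _ _ hab) (hqf _ _ hac)
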